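/- **Definitions.** Clauses are finite sets of literals $x,\neg x$; the width of a clause is its number of literals. A CNF $\varphi$ is a finite set of clauses, a 3-CNF if every clause has width at most $3$. Its adjacency graph $G_\varphi$ is the bipartite graph whose left side is the set of clauses of $\varphi$ and whose right side is the set of variables appearing in $\varphi$; $C$ and $x$ are adjacent iff $x$ or $\neg x$ appears in $C$. A $(2,4)$-matching in $G_\varphi$ is a subgraph $F$ each of whose connected components is a tree with at most $4$ edges and in which each left vertex has degree exactly $2$. For real $\mu\ge 0$, the game $\mathrm{CoverGame}(G_\varphi,\mu)$ starts with the empty matching $F_0$; in step $i+1$ Choose either removes a connected component from $F_i$ (giving $F_{i+1}$), or, if $F_i$ has strictly fewer than $\mu$ connected components, picks a vertex $v$, and Cover has to answer with a $(2,4)$-matching $F_{i+1}$ that covers $v$ and of which each connected component of $F_i$ is a connected component. Cover wins if she has a strategy by which she is never unable to answer. For a field $\mathbb F$, $tr(\varphi)\subseteq\mathbb F[X,\overline X]$ consists of the polynomials $tr(C)$ for $C\in\varphi$, and $x^2-x$, $x+\bar x-1$ for each variable $x$ of $\varphi$, where $tr(x)=\bar x$, $tr(\neg x)=x$ and $tr(C)=\prod_{\ell\in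 C}tr(\ell)$. A semantical PCR refutation of a set $P$ of polynomials is a sequence $M_0,\dots,M_\ell$ of sets of polynomials with $M_0=\emptyset$, $1\in M_\ell$ and, for each $i\ge 1$, $M_i=M_{i-1}\cup\{p\}$ with $p\in P$, or $M_i$ is contained in the ideal generated by $M_{i-1}$, or $M_i\subseteq M_{i-1}$. Its monomial space is the maximum over $i$ of the number of distinct monomials appearing in $M_i$. A Resolution refutation of $\varphi$ is a sequence $M_0,\dots,M_\ell$ of sets of clauses (memory configurations) with $M_0=\emptyset$, the empty clause in $M_\ell$ and, for each $i\ge 1$, $M_i=M_{i-1}\cup\{C\}$ with $C\in\varphi$, or $M_i=M_{i-1}\cup\{C\vee D\}$ with $C\vee x,\ D\vee\neg x\in M_{i-1}$ for some variable $x$, or $M_i\subseteq M_{i-1}$. Its total space is the maximum over $i$ of the number of literals, counted with repetitions, occurring in $M_i$. **Statement.** Let $\varphi$ be an unsatisfiable 3-CNF, let $\mu\ge 0$ be a real number, and suppose that Cover wins $\mathrm{CoverGame}(G_\varphi,\mu)$. Then, for every field $\mathbb F$, every semantical PCR refutation of $tr(\varphi)$ over $\mathbb F$ has monomial space at least $\mu/4$.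 Moreover, every Resolution refutation of $\varphi$ passes through a memory configuration containing at least $\mu/2$ clauses each of width at least $\mu/2$; in particular, its total space is at least $\mu^2/4$. -/

import Mathlib

namespace SpaceComplexity

section CNF

/-- A literal over the variables `V`: `(x, true)` is the literal `x` and `(x, false)` is `¬ x`. -/
abbrev Literal (V : Type*) := V × Bool

/-- A clause is a finite set of literals (their disjunction); its width is its cardinality, and
the empty clause is `∅`. -/
abbrev Clause (V : Type*) := Finset (Literal V)

/-- A CNF is a finite set of clauses (their conjunction). -/
abbrev CNF (V : Type*) := Finset (Clause V)

/-- The total assignment `a` satisfies the clause `C`. -/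
def Clause.Sat {V : Type*} (a : V → Bool) (C : Clause V) : Prop :=
  ∃ l ∈ C, a l.1 = l.2

def CNF.Unsatisfiable {V : Type*} (φ : CNF V) : Prop :=
  ¬ ∃ a : V → Bool, ∀ C ∈ φ, Clause.Sat a C

/-- `φ` is a `k`-CNF: each clause contains at most `k` literals. -/
def CNF.IsKCNF {V : Type*} (k : ℕ) (φ : CNF V) : Prop :=
  ∀ C ∈ φ, C.card ≤ k

/-- The set of variables appearing in `φ`. -/
def CNF.vars {V : Type*} [DecidableEq V] (φ : CNF V) : Finset V :=
  φ.biUnion fun C => C.image Prod.fst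

/-- The adjacency graph of `φ`: the left side is the set of clauses of `φ`, the right side is the
set of variables appearing in `φ`, and `C` is joined to `x` iff `x` or `¬ x` appears in `C`. -/
def CNF.adjacencyGraph {V : Type*} [DecidableEq V] (φ : CNF V) :
    SimpleGraph ({C : Clause V // C ∈ φ} ⊕ {x : V // x ∈ φ.vars}) where
  Adj u v := match u, v with
    | .inl C, .inr x => (x.1, true) ∈ C.1 ∨ (x.1, false) ∈ C.1
    | .inr x, .inl C => (x.1, true) ∈ C.1 ∨ (x.1, false) ∈ C.1
    | .inl _, .inl _ => False
    | .inr _, .inr _ => False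
  symm := ⟨by rintro (C | x) (D | y) h <;> exact h⟩
  loopless := ⟨by rintro (C | x) h <;> exact h⟩

end CNF

section CoverGame

/-- `H` is a connected component of the subgraph `F`: a maximal connected subgraph of `F`
(an isolated vertex of `F` is a component). -/
def IsComponent {W : Type*} {G : SimpleGraph W} (F H : G.Subgraph) : Prop :=
  Maximal (fun K : G.Subgraph => K ≤ F ∧ K.Connected) H

/-- `F` is an `(h, k)`-matching in the graph `G` with left side `A` and right side `B`: each
connected component of `F` is a tree with at most `k` edges, and each left vertex of `F` has degree
exactly `h` in `F`. -/
def IsHKMatching {A B : Type*} (h k : ℕ) {G : SimpleGraph (A ⊕ B)} (F : G.Subgraph) : Prop :=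
  (∀ H : G.Subgraph, IsComponent F H → H.coe.IsTree ∧ H.edgeSet.encard ≤ k) ∧
  (∀ a : A, Sum.inl a ∈ F.verts → (F.neighborSet (Sum.inl a)).encard = h)

/-- `F'` extends `F`: each connected component of `F` is a connected component of `F'`. -/
def Extends {W : Type*} {G : SimpleGraph W} (F' F : G.Subgraph) : Prop :=
  ∀ H : G.Subgraph, IsComponent F H → IsComponent F' H

/-- The number of connected components of `F` is strictly less than `μ`. -/
def FewerComponents {W : Type*} {G : SimpleGraph W} (F : G.Subgraph) (μ : ℝ) : Prop :=
  {H : G.Subgraph | IsComponent F H}.Finite ∧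
    ({H : G.Subgraph | IsComponent F H}.ncard : ℝ) < μ

/-- A strategy for Cover: given the nonempty history of the positions so far (the most recent one
first) and the vertex just picked by Choose, it returns Cover's next position. -/
abbrev CoverStrategy {W : Type*} (G : SimpleGraph W) := List G.Subgraph → W → G.Subgraph

/-- The histories (most recent position first) of the cover game with bound `μ`
that can arise when Cover follows the strategy `σ`. The game starts from the empty matching. -/
inductive History {W : Type*} {G : SimpleGraph W} (μ : ℝ) (σ : CoverStrategy G) :
    List G.Subgraph → Prop
  | start : History μ σ [⊥]
  | remove (F H : G.Subgraph) (l : List G.Subgraph) :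
      History μ σ (F :: l) → IsComponent F H →
      History μ σ (F.deleteVerts H.verts :: F :: l)
  | challenge (F : G.Subgraph) (l : List G.Subgraph) (v : W) :
      History μ σ (F :: l) → FewerComponents F μ →
      History μ σ (σ (F :: l) v :: F :: l)

/-- Cover wins the cover game with parameters `h, k` on `(G, μ)`: she has a strategy which answers
every challenge that Choose can ever make with an `(h, k)`-matching that extends the
current one and covers the vertex picked by Choose. -/
def CoverWins {A B : Type*} (h k : ℕ) (G : SimpleGraph (A ⊕ B)) (μ : ℝ) : Prop :=
  ∃ σ : CoverStrategy G, ∀ (F : G.Subgraph) (l : List G.Subgraph),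
    History μ σ (F :: l) → FewerComponents F μ → ∀ v : A ⊕ B,
      IsHKMatching h k (σ (F :: l) v) ∧ Extends (σ (F :: l) v) F ∧ v ∈ (σ (F :: l) v).verts

end CoverGame

section Resolution

/-- One step between memory configurations in Resolution: axiom download, adding the conclusion
`C ∨ D` of the resolution rule from `C ∨ x` and `D ∨ ¬ x`, or erasure. -/
inductive ResStep {V : Type*} [DecidableEq V] (φ : CNF V) :
    Finset (Clause V) → Finset (Clause V) → Prop
  | download (M : Finset (Clause V)) (C : Clause V) : C ∈ φ → ResStep φ M (insert C M)
  | inference (M : Finset (Clause V)) (C D : Clause V) (x : V) :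
      insert (x, true) C ∈ M → insert (x, false) D ∈ M → ResStep φ M (insert (C ∪ D) M)
  | erasure (M M' : Finset (Clause V)) : M' ⊆ M → ResStep φ M M'

/-- A Resolution refutation of `φ`, as a sequence of memory configurations. -/
structure ResRefutation {V : Type*} [DecidableEq V] (φ : CNF V) where
  length : ℕ
  config : Fin (length + 1) → Finset (Clause V)
  init : config 0 = ∅
  final : (∅ : Clause V) ∈ config (Fin.last length)
  step : ∀ i : Fin length, ResStep φ (config i.castSucc) (config i.succ)

/-- Total space: the maximum over the configurations of the number of literals, counted with
repetitions, occurring in the configuration. -/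
def ResRefutation.totalSpace {V : Type*} [DecidableEq V] {φ : CNF V} (π : ResRefutation φ) : ℕ :=
  Finset.univ.sup fun i => ∑ C ∈ π.config i, C.card

end Resolution

section PCR

/-- The polynomial ring `𝔽[X, X̄]`: the variable `Sum.inl x` is `x` and `Sum.inr x` is `x̄`. -/
abbrev PCRPoly (𝔽 V : Type*) [Field 𝔽] := MvPolynomial (V ⊕ V) 𝔽

/-- `tr x = x̄` and `tr (¬ x) = x`. -/
noncomputable def trLiteral {V : Type*} (𝔽 : Type*) [Field 𝔽] (l : Literal V) : PCRPoly 𝔽 V :=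
  if l.2 then MvPolynomial.X (Sum.inr l.1) else MvPolynomial.X (Sum.inl l.1)

noncomputable def trClause {V : Type*} (𝔽 : Type*) [Field 𝔽] (C : Clause V) : PCRPoly 𝔽 V :=
  ∏ l ∈ C, trLiteral 𝔽 l

/-- The standard encoding of `φ`: the polynomials `tr C` for the clauses `C` of `φ`, and the
boolean axioms `x ^ 2 - x` and `x + x̄ - 1` for the variables `x` of `φ`. -/
def trCNF {V : Type*} [DecidableEq V] (𝔽 : Type*) [Field 𝔽] (φ : CNF V) : Set (PCRPoly 𝔽 V) :=
  {p | ∃ C ∈ φ, p = trClause 𝔽 C} ∪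
  {p | ∃ x ∈ φ.vars,
    p = MvPolynomial.X (Sum.inl x) ^ 2 - MvPolynomial.X (Sum.inl x) ∨
    p = MvPolynomial.X (Sum.inl x) + MvPolynomial.X (Sum.inr x) - 1}

/-- One step between memory configurations in semantical PCR: axiom download, semantical inference,
or erasure. -/
inductive SemPCRStep {V 𝔽 : Type*} [Field 𝔽] (P : Set (PCRPoly 𝔽 V)) :
    Set (PCRPoly 𝔽 V) → Set (PCRPoly 𝔽 V) → Prop
  | download (M : Set (PCRPoly 𝔽 V)) (p : PCRPoly 𝔽 V) : p ∈ P → SemPCRStep P M (M ∪ {p})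
  | inference (M M' : Set (PCRPoly 𝔽 V)) :
      (∀ q ∈ M', q ∈ Ideal.span M) → SemPCRStep P M M'
  | erasure (M M' : Set (PCRPoly 𝔽 V)) : M' ⊆ M → SemPCRStep P M M'

/-- A semantical PCR refutation of `P`, as a sequence of memory configurations. -/
structure SemPCRRefutation {V 𝔽 : Type*} [Field 𝔽] (P : Set (PCRPoly 𝔽 V)) where
  length : ℕ
  config : Fin (length + 1) → Set (PCRPoly 𝔽 V)
  init : config 0 = ∅
  final : (1 : PCRPoly 𝔽 V) ∈ config (Fin.last length)
  step : ∀ i : Fin length, SemPCRStep P (config i.castSucc) (config i.succ)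

/-- Monomial space: the maximum over the configurations of the number of distinct monomials
appearing in the configuration (`⊤` if some configuration has infinitely many). -/
noncomputable def SemPCRRefutation.monomialSpace {V 𝔽 : Type*} [Field 𝔽] {P : Set (PCRPoly 𝔽 V)}
    (π : SemPCRRefutation P) : ℕ∞ :=
  ⨆ i, {m : (V ⊕ V) →₀ ℕ | ∃ p ∈ π.config i, m ∈ p.support}.encard

end PCR

end SpaceComplexity

/-!
Cover's winning strategy is turned into a family of piecewise partial assignments. A component of a
`(2, 4)`-matching is a tree in which every clause has exactly two neighbours; asking that exactly
one of the two corresponding literals be true is a parity condition on the tree, so that there is an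
assignment to the variables of the component which, together with its complement, satisfies all its
clauses (`IsMatchingTree.exists_isTwoSided`). A position of the game thus becomes a set of disjoint
pieces, with one free bit for each piece, and Cover's answers say that a position with fewer than
`μ` pieces can be enlarged by one piece so as to set any variable to any value or to satisfy any
clause (`CoverWins.nonempty_piecewiseFamily`).

For Resolution, call a clause wide if its width is at least `μ / 2`, and suppose that each
configuration has fewer than `μ / 2` wide clauses. The empty clause is narrow and falsified, so
there is a first configuration with a narrow clause falsified by a piecewise assignment, for which
fewer than `μ / 2` pieces suffice. Below `μ` pieces there remains room for one piece for each wide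
clause in memory, so the assignment can be extended along the earlier configurations to satisfy all
wide clauses (`WideSatisfiable.step`). Since the narrow clauses in memory are not falsified by any
piecewise assignment, the step that produces the falsified clause would be unsound
(`PiecewiseFamily.exists_card_wideClauses_ge`).

For semantical PCR, the invariant is that a configuration vanishes on all Boolean assignments
that meet the constraints of a block family: disjoint groups of at most two pieces, each with a
constraint that leaves every single variable free. The locality lemma
(`IsBlockFamily.exists_card_le`), which rests on Hall's theorem, reduces the number of blocks to at
most twice the number of monomials. With fewer than `μ / 4` monomials in memory there are therefore
always fewer than `μ` pieces, so that each downloaded clause can be satisfied by one more piece, and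
`1` is never derived (`PiecewiseFamily.ofReal_le_monomialSpace`).
-/

namespace SpaceComplexity

/-! ### Connected components of subgraphs -/

section Components

open SimpleGraph

variable {W : Type*} {G : SimpleGraph W}

lemma IsComponent.le_of_connected {F H K : G.Subgraph} (hH : IsComponent F H) (hKF : K ≤ F)
    (hK : K.Connected) {v : W} (hvH : v ∈ H.verts) (hvK : v ∈ K.verts) : K ≤ H := by
  have hsup : (H ⊔ K).Connected :=
    Subgraph.connected_sup hH.prop.2.preconnected hK.preconnected ⟨v, hvH, hvK⟩
  exact le_sup_right.trans (hH.le_of_ge ⟨sup_le hH.prop.1 hKF, hsup⟩ le_sup_left)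

lemma IsComponent.eq_of_mem {F H K : G.Subgraph} (hH : IsComponent F H) (hK : IsComponent F K)
    {v : W} (hvH : v ∈ H.verts) (hvK : v ∈ K.verts) : H = K :=
  le_antisymm (hK.le_of_connected hH.prop.1 hH.prop.2 hvK hvH)
    (hH.le_of_connected hK.prop.1 hK.prop.2 hvH hvK)

lemma IsComponent.adj {F H : G.Subgraph} (hH : IsComponent F H) {v w : W} (hv : v ∈ H.verts)
    (h : F.Adj v w) : H.Adj v w := by
  have hle : G.subgraphOfAdj h.adj_sub ≤ F := subgraphOfAdj_le_of_adj F h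
  have := hH.le_of_connected hle (Subgraph.subgraphOfAdj_connected _) hv (by simp)
  exact this.2 (by simp)

lemma IsComponent.neighborSet_eq {F H : G.Subgraph} (hH : IsComponent F H) {v : W}
    (hv : v ∈ H.verts) : H.neighborSet v = F.neighborSet v :=
  Set.ext fun _ => ⟨fun h => hH.prop.1.2 h, fun h => hH.adj hv h⟩

lemma exists_isComponent_mem [Finite W] (F : G.Subgraph) {v : W} (hv : v ∈ F.verts) :
    ∃ H, IsComponent F H ∧ v ∈ H.verts := by
  obtain ⟨H, hvH, hH⟩ := Finite.exists_le_maximal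
    (p := fun K : G.Subgraph => K ≤ F ∧ K.Connected) (a := G.singletonSubgraph v)
    ⟨(singletonSubgraph_le_iff v F).2 hv, Subgraph.singletonSubgraph_connected⟩
  exact ⟨H, hH, hvH.1 (by simp)⟩

lemma not_isComponent_bot (H : G.Subgraph) : ¬ IsComponent ⊥ H := fun hH => by
  obtain ⟨v, hv⟩ := hH.prop.2.nonempty
  simpa using hH.prop.1.1 hv

lemma isComponent_deleteVerts_iff [Finite W] {F H K : G.Subgraph} (hH : IsComponent F H) :
    IsComponent (F.deleteVerts H.verts) K ↔ IsComponent F K ∧ K ≠ H := by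
  -- A component other than `H` survives the deletion as a subgraph.
  have key : ∀ {K : G.Subgraph}, IsComponent F K → K ≠ H → K ≤ F.deleteVerts H.verts := by
    intro K hK hne
    have hdisj : ∀ v ∈ K.verts, v ∉ H.verts := fun v hv hv' => hne (hK.eq_of_mem hH hv hv')
    refine ⟨fun v hv => ?_, fun v w hvw => ?_⟩
    · simpa using ⟨hK.prop.1.1 hv, hdisj v hv⟩
    · rw [Subgraph.deleteVerts_adj]
      exact ⟨hK.prop.1.1 hvw.fst_mem, hdisj v hvw.fst_mem, hK.prop.1.1 hvw.snd_mem,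
        hdisj w hvw.snd_mem, hK.prop.1.2 hvw⟩
  constructor
  · intro hK
    obtain ⟨v, hv⟩ := hK.prop.2.nonempty
    have hvF := hK.prop.1.1 hv
    simp only [Subgraph.deleteVerts_verts, Set.mem_sdiff] at hvF
    obtain ⟨K', hK', hvK'⟩ := exists_isComponent_mem F hvF.1
    have hne : K' ≠ H := by rintro rfl; exact hvF.2 hvK'
    have h1 : K ≤ K' := hK'.le_of_connected (hK.prop.1.trans Subgraph.deleteVerts_le)
      hK.prop.2 hvK' hv
    have h2 : K' ≤ K := hK.le_of_ge ⟨key hK' hne, hK'.prop.2⟩ h1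
    obtain rfl := le_antisymm h1 h2
    exact ⟨hK', hne⟩
  · rintro ⟨hK, hne⟩
    exact ⟨⟨key hK hne, hK.prop.2⟩, fun L hL hle =>
      hK.le_of_ge ⟨hL.1.trans Subgraph.deleteVerts_le, hL.2⟩ hle⟩

end Components

/-! ### Complementary satisfying assignments on tree components -/

section Potential

open SimpleGraph

/-- On a tree every symmetric edge weighting with values in `ZMod 2` is a coboundary: take for the
potential of `v` the total weight of the path from a fixed root to `v`. -/
lemma exists_potential_of_isTree {W : Type*} {T : SimpleGraph W} (hT : T.IsTree)
    (w : W → W → ZMod 2) (hw : ∀ u v, w u v = w v u) :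
    ∃ c : W → ZMod 2, ∀ u v, T.Adj u v → c u + c v = w u v := by
  classical
  obtain ⟨r⟩ := hT.1.nonempty
  choose p hp _ using fun v => hT.existsUnique_path r v
  let wt : ∀ v, T.Walk r v → ZMod 2 := fun v q => (q.darts.map fun d => w d.fst d.snd).sum
  have hconcat : ∀ u v (q : T.Walk r u) (h : T.Adj u v),
      wt v (q.concat h) = wt u q + w u v := by
    intro u v q h
    simp [wt, Walk.darts_concat]
  have two : ∀ a b : ZMod 2, a + (a + b) = b := by decide
  refine ⟨fun v => wt v (p v), fun u v huv => ?_⟩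
  show wt u (p u) + wt v (p v) = w u v
  by_cases hu : u ∈ (p v).support
  · rw [hT.2.path_concat (hp u) (hp v) huv hu, hconcat, two]
  · have hv : v ∈ (p u).support :=
      hT.2.mem_support_of_ne_mem_support_of_adj_of_isPath (hp u) (hp v) huv hu
    rw [hT.2.path_concat (hp v) (hp u) huv.symm hv, hconcat, add_comm, two, hw]

variable {V : Type*} [DecidableEq V] {φ : CNF V}

/-- `α` and its complement both satisfy every clause in `T`, by means of variables in `T`. The
two assignments are `fun x => b ^^ α x` for the two values of `b`. -/
def IsTwoSided (T : φ.adjacencyGraph.Subgraph) (α : V → Bool) : Prop :=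
  ∀ C, Sum.inl C ∈ T.verts → ∀ b : Bool,
    ∃ l ∈ C.1, (∃ h, Sum.inr ⟨l.1, h⟩ ∈ T.verts) ∧ (b ^^ α l.1) = l.2

/-- `T` is a tree in which each clause has exactly two neighbours. -/
def IsMatchingTree (T : φ.adjacencyGraph.Subgraph) : Prop :=
  T.coe.IsTree ∧ ∀ C, Sum.inl C ∈ T.verts → (T.neighborSet (Sum.inl C)).encard = 2

/-- Each clause of a matching tree demands that exactly one of its two literals be true. These
demands are parity conditions along the edges of a tree, hence simultaneously satisfiable, and they
are invariant under complementation. -/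
lemma IsMatchingTree.exists_isTwoSided {T : φ.adjacencyGraph.Subgraph} (hT : IsMatchingTree T) :
    ∃ α, IsTwoSided T α := by
  classical
  have hnb : ∀ C, Sum.inl C ∈ T.verts → ∃ x y, x ≠ y ∧
      T.Adj (Sum.inl C) (Sum.inr x) ∧ T.Adj (Sum.inl C) (Sum.inr y) := by
    intro C hC
    obtain ⟨u, v, huv, hset⟩ := Set.encard_eq_two.1 (hT.2 C hC)
    have hu : T.Adj (Sum.inl C) u := by
      change u ∈ T.neighborSet (Sum.inl C); rw [hset]; simp
    have hv : T.Adj (Sum.inl C) v := by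
      change v ∈ T.neighborSet (Sum.inl C); rw [hset]; simp
    rcases u with D | x
    · exact absurd hu.adj_sub id
    rcases v with D | y
    · exact absurd hv.adj_sub id
    exact ⟨x, y, fun h => huv (h ▸ rfl), hu, hv⟩
  choose fst snd hne hfst hsnd using hnb
  -- `e` encodes the sign of `x` in `C`, and singles out one of the two neighbours of `C`.
  let e : {C : Clause V // C ∈ φ} → {x : V // x ∈ φ.vars} → ZMod 2 := fun C x =>
    (if (x.1, true) ∈ C.1 then 1 else 0) + (if ∃ h, x = fst C h then 1 else 0)
  let w : T.verts → T.verts → ZMod 2 := fun u v =>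
    match u.1, v.1 with
    | .inl C, .inr x => e C x
    | .inr x, .inl C => e C x
    | _, _ => 0
  obtain ⟨c, hc⟩ := exists_potential_of_isTree hT.1 w (by
    rintro ⟨C | x, hu⟩ ⟨D | y, hv⟩ <;> rfl)
  let α : V → Bool := fun x =>
    if h : ∃ h, Sum.inr ⟨x, h⟩ ∈ T.verts then decide (c ⟨_, h.choose_spec⟩ = 1) else false
  have hα : ∀ (x : {x : V // x ∈ φ.vars}) (h : Sum.inr x ∈ T.verts),
      α x.1 = decide (c ⟨Sum.inr x, h⟩ = 1) := fun x h => dif_pos ⟨x.2, h⟩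
  refine ⟨α, fun C hC b => ?_⟩
  -- The bit of a neighbour `x`, corrected by the sign of `x` in `C`.
  have key : ∀ (x : {x : V // x ∈ φ.vars}) (hx : T.Adj (Sum.inl C) (Sum.inr x)),
      (b ^^ α x.1) = (decide ((x.1, true) ∈ C.1) ^^ b ^^ decide (∃ h, x = fst C h) ^^
        decide (c ⟨Sum.inl C, hC⟩ = 1)) := by
    intro x hx
    have h1 := hc ⟨_, hC⟩ ⟨_, hx.snd_mem⟩ hx
    rw [hα x hx.snd_mem]
    have h2 : c ⟨Sum.inr x, hx.snd_mem⟩ = e C x + c ⟨Sum.inl C, hC⟩ := by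
      have h1' : c ⟨Sum.inl C, hC⟩ + c ⟨Sum.inr x, hx.snd_mem⟩ = e C x := h1
      rw [← h1']
      generalize c ⟨Sum.inl C, hC⟩ = p
      generalize c ⟨Sum.inr x, hx.snd_mem⟩ = q
      revert p q; decide
    rw [h2]
    have he : e C x = (if decide ((x.1, true) ∈ C.1) = true then 1 else 0) +
        (if decide (∃ h, x = fst C h) = true then 1 else 0) := by
      simp only [e, decide_eq_true_eq]
    rw [he]
    generalize c ⟨Sum.inl C, hC⟩ = p
    generalize decide ((x.1, true) ∈ C.1) = P
    generalize decide (∃ h, x = fst C h) = Q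
    decide +revert
  have hlit : ∀ (x : {x : V // x ∈ φ.vars}), T.Adj (Sum.inl C) (Sum.inr x) →
      (x.1, decide ((x.1, true) ∈ C.1)) ∈ C.1 := by
    intro x hx
    have : (x.1, true) ∈ C.1 ∨ (x.1, false) ∈ C.1 := hx.adj_sub
    by_cases h : (x.1, true) ∈ C.1
    · simp [h]
    · simpa [h] using this.resolve_left h
  have hd1 : decide (∃ h, fst C hC = fst C h) = true := by simp [hC]
  have hd2 : decide (∃ h, snd C hC = fst C h) = false := by
    simpa using fun h => (hne C h).symm
  have k1 := key _ (hfst C hC)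
  have k2 := key _ (hsnd C hC)
  rw [hd1] at k1
  rw [hd2] at k2
  by_cases hb : (b ^^ decide (c ⟨Sum.inl C, hC⟩ = 1)) = true
  · refine ⟨_, hlit _ (hfst C hC), ⟨(fst C hC).2, (hfst C hC).snd_mem⟩, k1.trans ?_⟩
    revert hb
    generalize decide (c ⟨Sum.inl C, hC⟩ = 1) = p
    generalize decide (((fst C hC).1, true) ∈ C.1) = q
    cases b <;> cases p <;> cases q <;> simp
  · refine ⟨_, hlit _ (hsnd C hC), ⟨(snd C hC).2, (hsnd C hC).snd_mem⟩, k2.trans ?_⟩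
    revert hb
    generalize decide (c ⟨Sum.inl C, hC⟩ = 1) = p
    generalize decide (((snd C hC).1, true) ∈ C.1) = q
    cases b <;> cases p <;> cases q <;> simp

end Potential

/-! ### Piecewise assignments -/

/-- A family of piecewise partial assignments for `φ`. Each piece `T` has a domain `dom T` and two
complementary assignments `fun x => b ^^ val T x` to it. A position is a finite set of pieces with
disjoint domains; positions are closed under subsets, and a position with fewer than `μ` pieces can
be enlarged by a single piece so as to cover a given variable, or to satisfy a given clause
whichever of the two assignments is chosen on that piece. The piece supplied may already belong to
the position. -/
structure PiecewiseFamily {V : Type*} [DecidableEq V] (φ : CNF V) (μ : ℝ) (P : Type*)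
    [DecidableEq P] where
  dom : P → Set V
  val : P → V → Bool
  positions : Set (Finset P)
  empty_mem : ∅ ∈ positions
  mono : ∀ {S S' : Finset P}, S ∈ positions → S' ⊆ S → S' ∈ positions
  eq_of_mem_dom : ∀ {S : Finset P}, S ∈ positions → ∀ {T T' : P}, T ∈ S → T' ∈ S →
    ∀ {x : V}, x ∈ dom T → x ∈ dom T' → T = T'
  extend_var : ∀ {S : Finset P}, S ∈ positions → (S.card : ℝ) < μ → ∀ {x : V}, x ∈ φ.vars →
    ∃ T, insert T S ∈ positions ∧ x ∈ dom T
  extend_clause : ∀ {S : Finset P}, S ∈ positions → (S.card : ℝ) < μ → ∀ {C : Clause V}, C ∈ φ →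
    ∃ T, insert T S ∈ positions ∧ ∀ b : Bool, ∃ l ∈ C, l.1 ∈ dom T ∧ (b ^^ val T l.1) = l.2

/-- The assignment `a` agrees on the piece `T` with one of the two assignments of `T`. -/
def PiecewiseFamily.Consistent {V P : Type*} [DecidableEq V] [DecidableEq P] {φ : CNF V} {μ : ℝ}
    (D : PiecewiseFamily φ μ P) (T : P) (a : V → Bool) : Prop :=
  ∃ b : Bool, ∀ x ∈ D.dom T, a x = (b ^^ D.val T x)

section Strategy

open SimpleGraph

variable {V : Type*} [DecidableEq V] {φ : CNF V} {μ : ℝ}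

lemma History.isMatchingTree {σ : CoverStrategy φ.adjacencyGraph}
    (hσ : ∀ (F : φ.adjacencyGraph.Subgraph) (l : List φ.adjacencyGraph.Subgraph),
      History μ σ (F :: l) → FewerComponents F μ → ∀ v,
        IsHKMatching 2 4 (σ (F :: l) v) ∧ Extends (σ (F :: l) v) F ∧ v ∈ (σ (F :: l) v).verts)
    {L : List φ.adjacencyGraph.Subgraph} (hL : History μ σ L) :
    ∀ F l, L = F :: l → ∀ H, IsComponent F H → IsMatchingTree H := by
  induction hL with
  | start =>
    rintro F l h H hH
    obtain ⟨rfl, rfl⟩ := List.cons.inj h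
    exact absurd hH (not_isComponent_bot H)
  | remove F K l _ hK ih =>
    rintro F' l' h H hH
    obtain ⟨rfl, rfl⟩ := List.cons.inj h
    exact ih F l rfl H ((isComponent_deleteVerts_iff hK).1 hH).1
  | challenge F l v hF hlt ih =>
    rintro F' l' h H hH
    obtain ⟨rfl, rfl⟩ := List.cons.inj h
    obtain ⟨⟨h1, h2⟩, -, -⟩ := hσ F l hF hlt v
    refine ⟨(h1 H hH).1, fun C hC => ?_⟩
    rw [hH.neighborSet_eq hC]
    exact h2 C (hH.prop.1.1 hC)

/-- A winning strategy for Cover yields a family of piecewise assignments whose pieces are connected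
components: the positions are the sets of components that can arise in the game. -/
theorem CoverWins.nonempty_piecewiseFamily [DecidableEq φ.adjacencyGraph.Subgraph]
    (h : CoverWins 2 4 φ.adjacencyGraph μ) :
    Nonempty (PiecewiseFamily φ μ φ.adjacencyGraph.Subgraph) := by
  classical
  obtain ⟨σ, hσ⟩ := h
  let pos : Set (Finset φ.adjacencyGraph.Subgraph) :=
    {S | ∃ F l, History μ σ (F :: l) ∧ ∀ H, H ∈ S ↔ IsComponent F H}
  have hmono : ∀ S S' : Finset φ.adjacencyGraph.Subgraph, S ∈ pos → S' ⊆ S → S' ∈ pos := by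
    intro S S' hS hsub
    -- Choose removes the components outside `S'` one by one.
    induction hn : (S \ S').card generalizing S with
    | zero =>
      have : S ⊆ S' := by simpa using hn
      rwa [hsub.antisymm this]
    | succ n ih =>
      obtain ⟨H, hH⟩ : (S \ S').Nonempty := Finset.card_pos.1 (by omega)
      obtain ⟨hHS, hHS'⟩ := Finset.mem_sdiff.1 hH
      obtain ⟨F, l, hF, hcomp⟩ := hS
      refine ih (S.erase H) ⟨_, _, History.remove F H l hF ((hcomp H).1 hHS), fun K => ?_⟩
        (fun K hK => Finset.mem_erase.2 ⟨fun h => hHS' (h ▸ hK), hsub hK⟩) ?_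
      · rw [isComponent_deleteVerts_iff ((hcomp H).1 hHS), Finset.mem_erase, hcomp, and_comm]
      · rw [Finset.erase_sdiff_comm, Finset.card_erase_of_mem hH, hn]; rfl
  have hextend : ∀ S ∈ pos, (S.card : ℝ) < μ → ∀ v, ∃ T, insert T S ∈ pos ∧ v ∈ T.verts ∧
      IsMatchingTree T := by
    rintro S ⟨F, l, hF, hcomp⟩ hlt v
    have hset : {H | IsComponent F H} = (S : Set φ.adjacencyGraph.Subgraph) := by
      ext H; exact (hcomp H).symm
    have hfew : FewerComponents F μ := by
      rw [FewerComponents, hset, Set.ncard_coe_finset]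
      exact ⟨S.finite_toSet, hlt⟩
    obtain ⟨-, hext, hv⟩ := hσ F l hF hfew v
    have hF' := History.challenge F l v hF hfew
    obtain ⟨T, hT, hvT⟩ := exists_isComponent_mem _ hv
    have hfin : {H | IsComponent (σ (F :: l) v) H}.Finite := Set.toFinite _
    refine ⟨T, hmono hfin.toFinset _ ⟨_, _, hF', fun H => by simp⟩ ?_, hvT,
      hF'.isMatchingTree hσ _ _ rfl T hT⟩
    intro K hK
    rw [Set.Finite.mem_toFinset]
    rcases Finset.mem_insert.1 hK with rfl | hK
    · exact hT
    · exact hext K ((hcomp K).1 hK)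
  let val : φ.adjacencyGraph.Subgraph → V → Bool := fun T =>
    if h : ∃ α, IsTwoSided T α then h.choose else fun _ => false
  have hval : ∀ T, IsMatchingTree T → IsTwoSided T (val T) := by
    intro T hT
    have := hT.exists_isTwoSided
    simp only [val, dif_pos this]
    exact this.choose_spec
  exact ⟨{
    dom := fun T => {x | ∃ h, Sum.inr ⟨x, h⟩ ∈ T.verts}
    val := val
    positions := pos
    empty_mem := ⟨⊥, [], History.start, fun H => by simpa using not_isComponent_bot H⟩
    mono := fun hS hsub => hmono _ _ hS hsub
    eq_of_mem_dom := by
      rintro S ⟨F, l, hF, hcomp⟩ T T' hT hT' x ⟨_, hx⟩ ⟨_, hx'⟩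
      exact ((hcomp T).1 hT).eq_of_mem ((hcomp T').1 hT') hx hx'
    extend_var := by
      intro S hS hlt x hx
      obtain ⟨T, hT, hxT, -⟩ := hextend S hS hlt (Sum.inr ⟨x, hx⟩)
      exact ⟨T, hT, hx, hxT⟩
    extend_clause := by
      intro S hS hlt C hC
      obtain ⟨T, hT, hCT, htree⟩ := hextend S hS hlt (Sum.inl ⟨C, hC⟩)
      exact ⟨T, hT, hval T htree ⟨C, hC⟩ hCT⟩ }⟩

end Strategy

namespace PiecewiseFamily

variable {V P : Type*} [DecidableEq V] [DecidableEq P] {φ : CNF V} {μ : ℝ}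
  (D : PiecewiseFamily φ μ P)

/-- The pair `(S, a)` encodes the partial assignment that is `a` restricted to the domains of the
pieces in the position `S`; on each piece it has to be one of the two assignments of the piece. -/
def IsAssignment (S : Finset P) (a : V → Bool) : Prop :=
  S ∈ D.positions ∧ ∀ T ∈ S, D.Consistent T a

/-- The partial assignment `(S, a')` agrees with `(S, a)`. -/
def Agree (S : Finset P) (a' a : V → Bool) : Prop :=
  ∀ T ∈ S, ∀ x ∈ D.dom T, a' x = a x

/-- The partial assignment `(S, a)` makes some literal of `C` true. -/
def Satisfies (S : Finset P) (a : V → Bool) (C : Clause V) : Prop :=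
  ∃ l ∈ C, ∃ T ∈ S, l.1 ∈ D.dom T ∧ a l.1 = l.2

/-- The partial assignment `(S, a)` makes every literal of `C` false. -/
def Falsifies (S : Finset P) (a : V → Bool) (C : Clause V) : Prop :=
  ∀ l ∈ C, ∃ T ∈ S, l.1 ∈ D.dom T ∧ a l.1 ≠ l.2

variable {D}

lemma IsAssignment.subset {S S' : Finset P} {a : V → Bool} (h : D.IsAssignment S a)
    (hsub : S' ⊆ S) : D.IsAssignment S' a :=
  ⟨D.mono h.1 hsub, fun T hT => h.2 T (hsub hT)⟩

lemma Satisfies.extend {S S' : Finset P} {a a' : V → Bool} {C : Clause V}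
    (h : D.Satisfies S a C) (hsub : S ⊆ S') (hag : D.Agree S a' a) : D.Satisfies S' a' C := by
  obtain ⟨l, hl, T, hT, hx, hv⟩ := h
  exact ⟨l, hl, T, hsub hT, hx, (hag T hT _ hx).trans hv⟩

lemma Falsifies.extend {S S' : Finset P} {a a' : V → Bool} {C : Clause V}
    (h : D.Falsifies S a C) (hsub : S ⊆ S') (hag : D.Agree S a' a) : D.Falsifies S' a' C := by
  intro l hl
  obtain ⟨T, hT, hx, hv⟩ := h l hl
  exact ⟨T, hsub hT, hx, (hag T hT _ hx).symm ▸ hv⟩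

lemma Falsifies.not_satisfies {S : Finset P} {a : V → Bool} {C : Clause V}
    (h : D.Falsifies S a C) : ¬ D.Satisfies S a C := by
  rintro ⟨l, hl, -, -, -, hv⟩
  obtain ⟨-, -, -, hv'⟩ := h l hl
  exact hv' hv

/-- One piece for each literal suffices to falsify a clause. -/
lemma Falsifies.exists_subset {S : Finset P} {a : V → Bool} {C : Clause V}
    (h : D.Falsifies S a C) : ∃ S' ⊆ S, S'.card ≤ C.card ∧ D.Falsifies S' a C := by
  choose t ht hx hv using h
  refine ⟨C.attach.image fun l => t l.1 l.2, ?_, ?_, fun l hl => ⟨t l hl, ?_, hx l hl, hv l hl⟩⟩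
  · intro T hT
    obtain ⟨l, -, rfl⟩ := Finset.mem_image.1 hT
    exact ht l.1 l.2
  · exact Finset.card_image_le.trans (Finset.card_attach).le
  · exact Finset.mem_image.2 ⟨⟨l, hl⟩, Finset.mem_attach _ _, rfl⟩

lemma IsAssignment.exists_insert {S : Finset P} {a : V → Bool} (h : D.IsAssignment S a) {T : P}
    (hT : insert T S ∈ D.positions) (hTS : T ∉ S) (b : Bool) :
    ∃ a', D.IsAssignment (insert T S) a' ∧ D.Agree S a' a ∧
      ∀ x ∈ D.dom T, a' x = (b ^^ D.val T x) := by
  classical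
  have hag : D.Agree S (fun x => if x ∈ D.dom T then b ^^ D.val T x else a x) a := by
    intro T' hT' x hx
    refine if_neg fun hx' => hTS ?_
    rwa [D.eq_of_mem_dom hT (Finset.mem_insert_self T S) (Finset.mem_insert_of_mem hT') hx' hx]
  refine ⟨_, ⟨hT, fun T' hT' => ?_⟩, hag, fun x hx => if_pos hx⟩
  rcases Finset.mem_insert.1 hT' with rfl | hT'
  · exact ⟨b, fun x hx => if_pos hx⟩
  · obtain ⟨b', hb'⟩ := h.2 T' hT'
    exact ⟨b', fun x hx => (hag T' hT' x hx).trans (hb' x hx)⟩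

lemma IsAssignment.exists_extend_var {S : Finset P} {a : V → Bool} (h : D.IsAssignment S a)
    (hS : (S.card : ℝ) < μ) {x : V} (hx : x ∈ φ.vars) (hxS : ∀ T ∈ S, x ∉ D.dom T) (v : Bool) :
    ∃ S' a', D.IsAssignment S' a' ∧ S ⊆ S' ∧ D.Agree S a' a ∧
      (∃ T ∈ S', x ∈ D.dom T) ∧ a' x = v := by
  obtain ⟨T, hT, hxT⟩ := D.extend_var h.1 hS hx
  obtain ⟨a', ha', hag, hval⟩ := h.exists_insert hT (fun hTS => hxS T hTS hxT) (v ^^ D.val T x)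
  exact ⟨_, a', ha', Finset.subset_insert T S, hag, ⟨T, Finset.mem_insert_self T S, hxT⟩,
    by rw [hval x hxT]; simp⟩

lemma IsAssignment.exists_extend_clause {S : Finset P} {a : V → Bool} (h : D.IsAssignment S a)
    (hS : (S.card : ℝ) < μ) {C : Clause V} (hC : C ∈ φ) :
    ∃ S' a', D.IsAssignment S' a' ∧ S ⊆ S' ∧ D.Agree S a' a ∧ D.Satisfies S' a' C := by
  obtain ⟨T, hT, hsat⟩ := D.extend_clause h.1 hS hC
  by_cases hTS : T ∈ S
  · obtain ⟨b, hb⟩ := h.2 T hTS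
    obtain ⟨l, hl, hx, hv⟩ := hsat b
    exact ⟨S, a, h, subset_rfl, fun _ _ _ _ => rfl, l, hl, T, hTS, hx, (hb _ hx).trans hv⟩
  · obtain ⟨a', ha', hag, hval⟩ := h.exists_insert hT hTS false
    obtain ⟨l, hl, hx, hv⟩ := hsat false
    exact ⟨_, a', ha', Finset.subset_insert T S, hag, l, hl, T, Finset.mem_insert_self T S, hx,
      (hval _ hx).trans hv⟩

end PiecewiseFamily

/-! ### Total space in Resolution -/

section Resolution

/-- The clauses of `M` of width at least `μ / 2`. -/
noncomputable def wideClauses {V : Type*} (μ : ℝ) (M : Finset (Clause V)) : Finset (Clause V) :=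
  M.filter fun C => μ / 2 ≤ (C.card : ℝ)

lemma mem_wideClauses {V : Type*} {μ : ℝ} {M : Finset (Clause V)} {C : Clause V} :
    C ∈ wideClauses μ M ↔ C ∈ M ∧ μ / 2 ≤ (C.card : ℝ) := Finset.mem_filter

variable {V P : Type*} [DecidableEq V] [DecidableEq P] {φ : CNF V} {μ : ℝ}

open PiecewiseFamily

/-- No narrow clause of `M` is falsified by a piecewise assignment from `D`. -/
def NarrowSafe (D : PiecewiseFamily φ μ P) (M : Finset (Clause V)) : Prop :=
  ∀ C ∈ M, (C.card : ℝ) < μ / 2 → ∀ S a, D.IsAssignment S a → ¬ D.Falsifies S a C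

/-- Some extension of the partial assignment `(S₀, a₀)` by at most one piece for each wide clause of
`M` satisfies all wide clauses of `M`. -/
def WideSatisfiable (D : PiecewiseFamily φ μ P) (S₀ : Finset P) (a₀ : V → Bool)
    (M : Finset (Clause V)) : Prop :=
  ∃ S a, D.IsAssignment S a ∧ S₀ ⊆ S ∧ D.Agree S₀ a a₀ ∧
    S.card ≤ S₀.card + (wideClauses μ M).card ∧ ∀ C ∈ wideClauses μ M, D.Satisfies S a C

variable {D : PiecewiseFamily φ μ P} {M M' : Finset (Clause V)} {S₀ : Finset P} {a₀ : V → Bool}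

/-- The size bound in `WideSatisfiable` comes for free: keep one piece for each wide clause. -/
lemma WideSatisfiable.of_extension {S : Finset P} {a : V → Bool} (h : D.IsAssignment S a)
    (hsub : S₀ ⊆ S) (hag : D.Agree S₀ a a₀) (hsat : ∀ C ∈ wideClauses μ M, D.Satisfies S a C) :
    WideSatisfiable D S₀ a₀ M := by
  choose l hl T hT hx hv using hsat
  set S₁ := (wideClauses μ M).attach.image fun C => T C.1 C.2
  have hS₁S : S₁ ⊆ S := by
    intro T' hT'
    obtain ⟨C, -, rfl⟩ := Finset.mem_image.1 hT'
    exact hT C.1 C.2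
  refine ⟨S₀ ∪ S₁, a, h.subset (Finset.union_subset hsub hS₁S), Finset.subset_union_left, hag,
    ?_, fun C hC => ⟨l C hC, hl C hC, T C hC, ?_, hx C hC, hv C hC⟩⟩
  · have h1 : S₁.card ≤ (wideClauses μ M).card :=
      Finset.card_image_le.trans Finset.card_attach.le
    have h2 := Finset.card_union_le S₀ S₁
    omega
  · exact Finset.mem_union_right _
      (Finset.mem_image.2 ⟨⟨C, hC⟩, Finset.mem_attach _ _, rfl⟩)

lemma not_falsifies_resolvent {S : Finset P} {a : V → Bool} (h : D.IsAssignment S a)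
    (hS : (S.card : ℝ) < μ) (hvars : ∀ C ∈ M, ∀ l ∈ C, l.1 ∈ φ.vars) (hsafe : NarrowSafe D M)
    (hsat : ∀ C ∈ wideClauses μ M, D.Satisfies S a C) {A B : Clause V} {x : V}
    (hA : insert (x, true) A ∈ M) (hB : insert (x, false) B ∈ M) :
    ¬ D.Falsifies S a (A ∪ B) := by
  intro hfal
  -- A premise falsified by `(S, a)` is impossible, be it wide or narrow.
  have hno : ∀ C ∈ M, ¬ D.Falsifies S a C := fun C hC hCf => by
    by_cases hw : μ / 2 ≤ (C.card : ℝ)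
    · exact hCf.not_satisfies (hsat C (mem_wideClauses.2 ⟨hC, hw⟩))
    · exact hsafe C hC (not_le.1 hw) S a h hCf
  by_cases hx : ∃ T ∈ S, x ∈ D.dom T
  · obtain ⟨T, hT, hxT⟩ := hx
    cases hax : a x with
    | false =>
      refine hno _ hA fun l hl => ?_
      rcases Finset.mem_insert.1 hl with rfl | hl
      · exact ⟨T, hT, hxT, by simp [hax]⟩
      · exact hfal l (Finset.mem_union_left _ hl)
    | true =>
      refine hno _ hB fun l hl => ?_
      rcases Finset.mem_insert.1 hl with rfl | hl
      · exact ⟨T, hT, hxT, by simp [hax]⟩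
      · exact hfal l (Finset.mem_union_right _ hl)
  · push Not at hx
    by_cases hw : μ / 2 ≤ ((insert (x, true) A : Clause V).card : ℝ)
    · obtain ⟨l, hl, T, hT, hxT, hv⟩ := hsat _ (mem_wideClauses.2 ⟨hA, hw⟩)
      rcases Finset.mem_insert.1 hl with rfl | hl
      · exact hx T hT hxT
      · obtain ⟨-, -, -, hv'⟩ := hfal l (Finset.mem_union_left _ hl)
        exact hv' hv
    · obtain ⟨S', a', h', hsub, hag, ⟨T, hT, hxT⟩, hv⟩ := h.exists_extend_var hS
        (hvars _ hA _ (Finset.mem_insert_self _ _)) hx false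
      refine hsafe _ hA (not_le.1 hw) S' a' h' fun l hl => ?_
      rcases Finset.mem_insert.1 hl with rfl | hl
      · exact ⟨T, hT, hxT, by simp [hv]⟩
      · exact hfal.extend hsub hag l (Finset.mem_union_left _ hl)

lemma ResStep.vars (h : ResStep φ M M') (hvars : ∀ C ∈ M, ∀ l ∈ C, l.1 ∈ φ.vars) :
    ∀ C ∈ M', ∀ l ∈ C, l.1 ∈ φ.vars := by
  cases h with
  | download C hC =>
    intro E hE l hl
    rcases Finset.mem_insert.1 hE with rfl | hE
    · exact Finset.mem_biUnion.2 ⟨E, hC, Finset.mem_image_of_mem _ hl⟩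
    · exact hvars E hE l hl
  | inference A B x hA hB =>
    intro E hE l hl
    rcases Finset.mem_insert.1 hE with rfl | hE
    · rcases Finset.mem_union.1 hl with hl | hl
      · exact hvars _ hA l (Finset.mem_insert_of_mem hl)
      · exact hvars _ hB l (Finset.mem_insert_of_mem hl)
    · exact hvars E hE l hl
  | erasure _ hsub => exact fun E hE => hvars E (hsub hE)

lemma WideSatisfiable.step (hM : WideSatisfiable D S₀ a₀ M) (h : ResStep φ M M')
    (hvars : ∀ C ∈ M, ∀ l ∈ C, l.1 ∈ φ.vars) (hsafe : NarrowSafe D M)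
    (hcard : ((S₀.card + (wideClauses μ M).card : ℕ) : ℝ) < μ) :
    WideSatisfiable D S₀ a₀ M' := by
  have hvars' := h.vars hvars
  obtain ⟨S, a, hSa, hsub, hag, hS, hsat⟩ := hM
  have hSμ : (S.card : ℝ) < μ := lt_of_le_of_lt (by exact_mod_cast hS) hcard
  -- It is enough to satisfy the one clause that is new in `M'`.
  have hnew : ∀ E, M' = insert E M → ∀ S' a', D.IsAssignment S' a' → S ⊆ S' → D.Agree S a' a →
      D.Satisfies S' a' E → WideSatisfiable D S₀ a₀ M' := by
    rintro E rfl S' a' h' hsub' hag' hE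
    refine .of_extension h' (hsub.trans hsub')
      (fun T hT x hx => (hag' T (hsub hT) x hx).trans (hag T hT x hx)) fun C hC => ?_
    obtain ⟨hC, hw⟩ := mem_wideClauses.1 hC
    rcases Finset.mem_insert.1 hC with rfl | hC
    · exact hE
    · exact (hsat C (mem_wideClauses.2 ⟨hC, hw⟩)).extend hsub' hag'
  cases h with
  | download C hC =>
    obtain ⟨S', a', h', hsub', hag', hC'⟩ := hSa.exists_extend_clause hSμ hC
    exact hnew C rfl S' a' h' hsub' hag' hC'
  | inference A B x hA hB =>
    have hnf := not_falsifies_resolvent hSa hSμ hvars hsafe hsat hA hB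
    by_cases hs : D.Satisfies S a (A ∪ B)
    · exact hnew _ rfl S a hSa subset_rfl (fun _ _ _ _ => rfl) hs
    · -- Neither satisfied nor falsified, the resolvent has a literal left unset.
      simp only [Falsifies, not_forall, not_exists, not_and, not_not] at hnf
      obtain ⟨l, hl, hlS⟩ := hnf
      have hunset : ∀ T ∈ S, l.1 ∉ D.dom T := fun T hT hx =>
        hs ⟨l, hl, T, hT, hx, hlS T hT hx⟩
      obtain ⟨S', a', h', hsub', hag', ⟨T, hT, hx⟩, hv⟩ := hSa.exists_extend_var hSμ
        (hvars' _ (Finset.mem_insert_self _ _) l hl) hunset l.2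
      exact hnew _ rfl S' a' h' hsub' hag' ⟨l, hl, T, hT, hx, hv⟩
  | erasure _ hM' =>
    refine .of_extension hSa hsub hag fun C hC => ?_
    obtain ⟨hC, hw⟩ := mem_wideClauses.1 hC
    exact hsat C (mem_wideClauses.2 ⟨hM' hC, hw⟩)

/-- A step cannot produce a clause falsified by `(S₀, a₀)`, if before the step narrow clauses are
safe and wide clauses can be satisfied by extending `(S₀, a₀)`. -/
lemma WideSatisfiable.not_falsifies (hM : WideSatisfiable D S₀ a₀ M) (h : ResStep φ M M')
    (hvars : ∀ C ∈ M, ∀ l ∈ C, l.1 ∈ φ.vars) (hsafe : NarrowSafe D M)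
    (hcard : ((S₀.card + (wideClauses μ M).card : ℕ) : ℝ) < μ) {C : Clause V} (hC : C ∈ M') :
    ¬ D.Falsifies S₀ a₀ C := by
  obtain ⟨S, a, hSa, hsub, hag, hS, hsat⟩ := hM
  have hSμ : (S.card : ℝ) < μ := lt_of_le_of_lt (by exact_mod_cast hS) hcard
  intro hf₀
  have hf := hf₀.extend hsub hag
  have hold : C ∉ M := fun hCM => by
    by_cases hw : μ / 2 ≤ (C.card : ℝ)
    · exact hf.not_satisfies (hsat C (mem_wideClauses.2 ⟨hCM, hw⟩))
    · exact hsafe C hCM (not_le.1 hw) S a hSa hf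
  cases h with
  | download E hE =>
    obtain rfl := (Finset.mem_insert.1 hC).resolve_right hold
    obtain ⟨S', a', h', hsub', hag', hC'⟩ := hSa.exists_extend_clause hSμ hE
    exact (hf.extend hsub' hag').not_satisfies hC'
  | inference A B x hA hB =>
    obtain rfl := (Finset.mem_insert.1 hC).resolve_right hold
    exact not_falsifies_resolvent hSa hSμ hvars hsafe hsat hA hB hf
  | erasure _ hM' => exact hold (hM' hC)

/-- Suppose that all configurations have few wide clauses, and consider the first one that contains
a narrow clause falsified by a piecewise assignment. That assignment may be taken with fewer than
`μ / 2` pieces, so that up to this moment there is room to extend it to all wide clauses in memory;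
the falsified clause is then unsound. -/
theorem PiecewiseFamily.exists_card_wideClauses_ge (D : PiecewiseFamily φ μ P)
    (π : ResRefutation φ) : ∃ i, μ / 2 ≤ ((wideClauses μ (π.config i)).card : ℝ) := by
  by_contra! hfew
  have hμ : 0 < μ / 2 := lt_of_le_of_lt (Nat.cast_nonneg _) (hfew 0)
  have hvars : ∀ i, ∀ C ∈ π.config i, ∀ l ∈ C, l.1 ∈ φ.vars := by
    intro i
    induction i using Fin.induction with
    | zero => rw [π.init]; simp
    | succ i ih => exact (π.step i).vars ih
  -- `j` is the first configuration with a narrow clause falsified by a piecewise assignment.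
  obtain ⟨j, hj, hmin⟩ : ∃ j, ¬ NarrowSafe D (π.config j) ∧
      ∀ i < j, NarrowSafe D (π.config i) := by
    have hex : ∃ j, ¬ NarrowSafe D (π.config j) := by
      refine ⟨Fin.last _, fun h => h ∅ π.final (by simpa using hμ) ∅ (fun _ => false)
        ⟨D.empty_mem, by simp⟩ (by simp [Falsifies])⟩
    obtain ⟨j, hj, hmin⟩ := WellFounded.has_min (wellFounded_lt (α := Fin (π.length + 1)))
      {j | ¬ NarrowSafe D (π.config j)} hex
    exact ⟨j, hj, fun i hi => not_not.1 fun h => hmin i h hi⟩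
  simp only [NarrowSafe, not_forall, not_not] at hj
  obtain ⟨C, hC, hnarrow, S, a, hSa, hf⟩ := hj
  obtain ⟨S₀, hsub, hcard, hf₀⟩ := hf.exists_subset
  have hS₀ : (S₀.card : ℝ) < μ / 2 := lt_of_le_of_lt (by exact_mod_cast hcard) hnarrow
  have hroom : ∀ i, ((S₀.card + (wideClauses μ (π.config i)).card : ℕ) : ℝ) < μ := by
    intro i
    push_cast
    linarith [hfew i]
  induction j using Fin.cases with
  | zero => rw [π.init] at hC; simp at hC
  | succ k =>
    have hws : ∀ i : Fin (π.length + 1), i ≤ k.castSucc →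
        WideSatisfiable D S₀ a (π.config i) := by
      intro i
      induction i using Fin.induction with
      | zero =>
        intro _
        refine .of_extension (hSa.subset hsub) subset_rfl (fun _ _ _ _ => rfl) ?_
        simp [π.init, wideClauses]
      | succ i ih =>
        intro hi
        have hlt : i.castSucc < k.castSucc := lt_of_lt_of_le Fin.castSucc_lt_succ hi
        exact (ih hlt.le).step (π.step i) (hvars _)
          (hmin _ (hlt.trans Fin.castSucc_lt_succ)) (hroom _)
    exact (hws _ le_rfl).not_falsifies (π.step k) (hvars _)
      (hmin _ Fin.castSucc_lt_succ) (hroom _) hC hf₀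

lemma ResRefutation.sq_div_four_le_totalSpace (hμ : 0 ≤ μ) (π : ResRefutation φ) {i}
    (hi : μ / 2 ≤ ((wideClauses μ (π.config i)).card : ℝ)) : μ ^ 2 / 4 ≤ (π.totalSpace : ℝ) := by
  have h1 : ∑ C ∈ π.config i, C.card ≤ π.totalSpace :=
    Finset.le_sup (f := fun i => ∑ C ∈ π.config i, C.card) (Finset.mem_univ i)
  have h2 : ∑ C ∈ wideClauses μ (π.config i), (C.card : ℝ) ≤ ∑ C ∈ π.config i, (C.card : ℝ) :=
    Finset.sum_le_sum_of_subset_of_nonneg (Finset.filter_subset _ _)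
      fun _ _ _ => Nat.cast_nonneg _
  have h3 : (wideClauses μ (π.config i)).card • (μ / 2) ≤
      ∑ C ∈ wideClauses μ (π.config i), (C.card : ℝ) :=
    Finset.card_nsmul_le_sum _ _ _ fun C hC => (mem_wideClauses.1 hC).2
  have h4 : (∑ C ∈ π.config i, (C.card : ℝ)) ≤ π.totalSpace := by exact_mod_cast h1
  rw [nsmul_eq_mul] at h3
  nlinarith

end Resolution

/-! ### A Hall-type decomposition -/

/-- For a relation given by neighbourhoods `N m`, take `s' ⊆ s` maximal with at most `2 * #s'`
neighbours; by Hall's theorem each of the other elements of `s` can be given two neighbours outside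
those of `s'`, without overlaps. -/
lemma exists_subset_double_matching {α β : Type*} [DecidableEq α] [DecidableEq β] (s : Finset α)
    (N : α → Finset β) :
    ∃ s' ⊆ s, (s'.biUnion N).card ≤ 2 * s'.card ∧
      ∃ f : {m // m ∈ s \ s'} × Bool → β, Function.Injective f ∧
        ∀ p, f p ∈ N p.1.1 \ s'.biUnion N := by
  obtain ⟨s', hs', hmax⟩ : ∃ s', (s' ⊆ s ∧ (s'.biUnion N).card ≤ 2 * s'.card) ∧
      ∀ t, t ⊆ s ∧ (t.biUnion N).card ≤ 2 * t.card → t.card ≤ s'.card := by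
    obtain ⟨s', hs', hmax⟩ := Finset.exists_max_image
      (s.powerset.filter fun t => (t.biUnion N).card ≤ 2 * t.card) Finset.card
      ⟨∅, by simp⟩
    simp only [Finset.mem_filter, Finset.mem_powerset] at hs' hmax
    exact ⟨s', hs', hmax⟩
  refine ⟨s', hs'.1, hs'.2, ?_⟩
  rw [← Finset.all_card_le_biUnion_card_iff_exists_injective
    (fun p : {m // m ∈ s \ s'} × Bool => N p.1.1 \ s'.biUnion N)]
  intro u
  set t : Finset α := u.image fun p => p.1.1 with ht
  have hts : ∀ m ∈ t, m ∈ s \ s' := by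
    intro m hm
    obtain ⟨p, -, rfl⟩ := Finset.mem_image.1 hm
    exact p.1.2
  have hu : u.card ≤ 2 * t.card := by
    refine Finset.card_le_mul_card_image (f := fun p => p.1.1) u 2 fun m hm => ?_
    refine (Finset.card_le_card_of_injOn Prod.snd (t := (Finset.univ : Finset Bool))
      (fun _ _ => Finset.mem_univ _) ?_).trans (by simp)
    rintro ⟨m₁, b₁⟩ h₁ ⟨m₂, b₂⟩ h₂ (rfl : b₁ = b₂)
    have e₁ : m₁.1 = m := (Finset.mem_filter.1 h₁).2
    have e₂ : m₂.1 = m := (Finset.mem_filter.1 h₂).2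
    rw [Subtype.ext (e₁.trans e₂.symm)]
  have hN : u.biUnion (fun p => N p.1.1 \ s'.biUnion N) = t.biUnion N \ s'.biUnion N := by
    ext b
    simp only [Finset.mem_biUnion, Finset.mem_sdiff, ht, Finset.mem_image]
    constructor
    · rintro ⟨p, hp, hb, hb'⟩
      exact ⟨⟨p.1.1, ⟨p, hp, rfl⟩, hb⟩, hb'⟩
    · rintro ⟨⟨m, ⟨p, hp, rfl⟩, hb⟩, hb'⟩
      exact ⟨p, hp, hb, hb'⟩
  rw [hN]
  rcases t.eq_empty_or_nonempty with h0 | hne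
  · simp [h0] at hu
    simp [hu]
  have hdisj : Disjoint s' t :=
    Finset.disjoint_right.2 fun m hm => (Finset.mem_sdiff.1 (hts m hm)).2
  have hcard := Finset.card_union_of_disjoint hdisj
  have hpos := hne.card_pos
  -- By maximality `s' ∪ t` has more than `2 * #(s' ∪ t)` neighbours.
  have hbig : 2 * (s' ∪ t).card < ((s' ∪ t).biUnion N).card := by
    by_contra! hle
    have := hmax (s' ∪ t) ⟨Finset.union_subset hs'.1
      fun m hm => (Finset.mem_sdiff.1 (hts m hm)).1, hle⟩
    omega
  have hunion : (s' ∪ t).biUnion N = s'.biUnion N ∪ (t.biUnion N \ s'.biUnion N) := by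
    rw [Finset.union_sdiff_self_eq_union, Finset.union_biUnion]
  rw [hunion] at hbig
  have := Finset.card_union_le (s'.biUnion N) (t.biUnion N \ s'.biUnion N)
  have := hs'.2
  omega

/-! ### Polynomials at Boolean points -/

section BooleanPoints

variable {V 𝔽 : Type*} [Field 𝔽]

/-- The point of `𝔽 ^ (V ⊕ V)` given by a Boolean assignment: `x̄` takes the value `1 - x`. -/
def boolPoint (𝔽 : Type*) [Field 𝔽] (a : V → Bool) : V ⊕ V → 𝔽 :=
  Sum.elim (fun x => if a x then 1 else 0) (fun x => if a x then 0 else 1)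

/-- The value of the monomial `m` under the assignment `a`. -/
def monVal (𝔽 : Type*) [Field 𝔽] (a : V → Bool) (m : (V ⊕ V) →₀ ℕ) : 𝔽 :=
  ∏ i ∈ m.support, boolPoint 𝔽 a i ^ m i

/-- The variable `x` or its dual `x̄` occurs in the monomial `m`. -/
def Touches (m : (V ⊕ V) →₀ ℕ) (x : V) : Prop :=
  Sum.inl x ∈ m.support ∨ Sum.inr x ∈ m.support

lemma monVal_congr {a a' : V → Bool} {m : (V ⊕ V) →₀ ℕ} (h : ∀ x, Touches m x → a x = a' x) :
    monVal 𝔽 a m = monVal 𝔽 a' m := by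
  refine Finset.prod_congr rfl fun i hi => ?_
  rcases i with x | x
  · simp [boolPoint, h x (Or.inl hi)]
  · simp [boolPoint, h x (Or.inr hi)]

lemma exists_monVal_eq_zero {m : (V ⊕ V) →₀ ℕ} {x : V} (h : Touches m x) :
    ∃ v : Bool, ∀ a : V → Bool, a x = v → monVal 𝔽 a m = 0 := by
  rcases h with h | h
  · refine ⟨false, fun a ha => Finset.prod_eq_zero h ?_⟩
    simp [boolPoint, ha, Finsupp.mem_support_iff.1 h]
  · refine ⟨true, fun a ha => Finset.prod_eq_zero h ?_⟩
    simp [boolPoint, ha, Finsupp.mem_support_iff.1 h]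

lemma eval_boolPoint (a : V → Bool) (p : PCRPoly 𝔽 V) :
    MvPolynomial.eval (boolPoint 𝔽 a) p = ∑ m ∈ p.support, p.coeff m * monVal 𝔽 a m :=
  MvPolynomial.eval_eq _ _

lemma eval_boolPoint_trClause {a : V → Bool} {C : Clause V} (h : Clause.Sat a C) :
    MvPolynomial.eval (boolPoint 𝔽 a) (trClause 𝔽 C) = 0 := by
  obtain ⟨⟨x, v⟩, hl, hv⟩ := h
  rw [trClause, map_prod]
  refine Finset.prod_eq_zero hl ?_
  cases v <;> simp_all [trLiteral, boolPoint]

/-- The assignment `a` is a common zero of the polynomials in `M`. -/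
def IsZeroOf (a : V → Bool) (M : Set (PCRPoly 𝔽 V)) : Prop :=
  ∀ p ∈ M, MvPolynomial.eval (boolPoint 𝔽 a) p = 0

lemma IsZeroOf.span {a : V → Bool} {M : Set (PCRPoly 𝔽 V)} (h : IsZeroOf a M)
    {q : PCRPoly 𝔽 V} (hq : q ∈ Ideal.span M) : MvPolynomial.eval (boolPoint 𝔽 a) q = 0 := by
  have : Ideal.span M ≤ RingHom.ker (MvPolynomial.eval (boolPoint 𝔽 a)) :=
    Ideal.span_le.2 fun p hp => h p hp
  exact this hq

lemma eval_boolPoint_eq_zero_of_mem_trCNF [DecidableEq V] {φ : CNF V} {a : V → Bool}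
    {p : PCRPoly 𝔽 V} (hp : p ∈ trCNF 𝔽 φ) (h : ∀ C ∈ φ, p = trClause 𝔽 C → Clause.Sat a C) :
    MvPolynomial.eval (boolPoint 𝔽 a) p = 0 := by
  rcases hp with ⟨C, hC, rfl⟩ | ⟨x, -, rfl | rfl⟩
  · exact eval_boolPoint_trClause (h C hC rfl)
  · cases hx : a x <;> simp [boolPoint, hx]
  · cases hx : a x <;> simp [boolPoint, hx]

end BooleanPoints

/-! ### Blocks of pieces and the locality lemma -/

section Locality

variable {V P : Type*} [DecidableEq V] [DecidableEq P] {φ : CNF V} {μ : ℝ}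

/-- A set of pieces with a constraint on the assignments to their domains. -/
structure Block (V P : Type*) where
  pieces : Finset P
  allowed : Set (V → Bool)

variable (D : PiecewiseFamily φ μ P)

/-- A valid block has at most two pieces, its constraint depends only on their domains, is stronger
than consistency with the pieces, and can be met with any prescribed value of any single variable
of the block. -/
structure Block.IsValid (B : Block V P) : Prop where
  card_le : B.pieces.card ≤ 2
  consistent : ∀ a ∈ B.allowed, ∀ T ∈ B.pieces, D.Consistent T a
  congr : ∀ a a' : V → Bool, (∀ T ∈ B.pieces, ∀ x ∈ D.dom T, a x = a' x) →
    a ∈ B.allowed → a' ∈ B.allowed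
  nonempty : B.allowed.Nonempty
  flip : ∀ T ∈ B.pieces, ∀ x ∈ D.dom T, ∀ v : Bool, ∃ a ∈ B.allowed, a x = v

/-- A finite set of valid blocks with disjoint sets of pieces, which together form a position. -/
structure IsBlockFamily (𝓑 : Finset (Block V P)) : Prop where
  valid : ∀ B ∈ 𝓑, B.IsValid D
  disjoint : ∀ B ∈ 𝓑, ∀ B' ∈ 𝓑, ∀ T, T ∈ B.pieces → T ∈ B'.pieces → B = B'
  mem_positions : 𝓑.biUnion Block.pieces ∈ D.positions

/-- The assignment `a` meets the constraints of all blocks. -/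
def Meets (𝓑 : Finset (Block V P)) (a : V → Bool) : Prop := ∀ B ∈ 𝓑, a ∈ B.allowed

variable {D} {𝓑 : Finset (Block V P)}

lemma IsBlockFamily.eq_of_mem_dom (h : IsBlockFamily D 𝓑) {B B' : Block V P} (hB : B ∈ 𝓑)
    (hB' : B' ∈ 𝓑) {T T' : P} (hT : T ∈ B.pieces) (hT' : T' ∈ B'.pieces) {x : V}
    (hx : x ∈ D.dom T) (hx' : x ∈ D.dom T') : B = B' := by
  obtain rfl := D.eq_of_mem_dom h.mem_positions (Finset.mem_biUnion.2 ⟨B, hB, hT⟩)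
    (Finset.mem_biUnion.2 ⟨B', hB', hT'⟩) hx hx'
  exact h.disjoint B hB B' hB' T hT hT'

lemma IsBlockFamily.card_pieces_le (h : IsBlockFamily D 𝓑) :
    (𝓑.biUnion Block.pieces).card ≤ 2 * 𝓑.card := by
  rw [mul_comm]
  exact Finset.card_biUnion_le_card_mul _ _ _ fun B hB => (h.valid B hB).card_le

/-- Allowed assignments of the individual blocks can be glued, over any assignment to the remaining
variables. -/
lemma IsBlockFamily.exists_glue (h : IsBlockFamily D 𝓑) (c : Block V P → V → Bool)
    (hc : ∀ B ∈ 𝓑, c B ∈ B.allowed) (a₀ : V → Bool) :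
    ∃ a, Meets 𝓑 a ∧ (∀ B ∈ 𝓑, ∀ T ∈ B.pieces, ∀ x ∈ D.dom T, a x = c B x) ∧
      ∀ x, (∀ B ∈ 𝓑, ∀ T ∈ B.pieces, x ∉ D.dom T) → a x = a₀ x := by
  classical
  let a : V → Bool := fun x =>
    if hx : ∃ B ∈ 𝓑, ∃ T ∈ B.pieces, x ∈ D.dom T then c hx.choose x else a₀ x
  have ha : ∀ B ∈ 𝓑, ∀ T ∈ B.pieces, ∀ x ∈ D.dom T, a x = c B x := by
    intro B hB T hT x hx
    have hex : ∃ B ∈ 𝓑, ∃ T ∈ B.pieces, x ∈ D.dom T := ⟨B, hB, T, hT, hx⟩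
    obtain ⟨h1, T', hT', hx'⟩ := hex.choose_spec
    have : a x = c hex.choose x := dif_pos hex
    rw [this, h.eq_of_mem_dom h1 hB hT' hT hx' hx]
  refine ⟨a, fun B hB => ?_, ha, fun x hx => dif_neg ?_⟩
  · exact (h.valid B hB).congr (c B) a (fun T hT x hx => (ha B hB T hT x hx).symm) (hc B hB)
  · rintro ⟨B, hB, T, hT, hxT⟩
    exact hx B hB T hT hxT

/-- The block on two pieces whose constraint is the disjunction of two values of variables, one from
each piece. -/
def pairBlock (D : PiecewiseFamily φ μ P) (T₁ T₂ : P) (x₁ x₂ : V) (v₁ v₂ : Bool) : Block V P where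
  pieces := {T₁, T₂}
  allowed := {a | D.Consistent T₁ a ∧ D.Consistent T₂ a ∧ (a x₁ = v₁ ∨ a x₂ = v₂)}

lemma isValid_pairBlock {T₁ T₂ : P} (hdisj : ∀ x, x ∈ D.dom T₁ → x ∉ D.dom T₂) {x₁ x₂ : V}
    (hx₁ : x₁ ∈ D.dom T₁) (hx₂ : x₂ ∈ D.dom T₂) (v₁ v₂ : Bool) :
    (pairBlock D T₁ T₂ x₁ x₂ v₁ v₂).IsValid D := by
  classical
  -- The bits on the two pieces may be chosen independently, so one variable from each piece can be
  -- given any value.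
  have key : ∀ y₁ ∈ D.dom T₁, ∀ y₂ ∈ D.dom T₂, ∀ w₁ w₂ : Bool, ∃ a : V → Bool,
      D.Consistent T₁ a ∧ D.Consistent T₂ a ∧ a y₁ = w₁ ∧ a y₂ = w₂ := by
    intro y₁ hy₁ y₂ hy₂ w₁ w₂
    have hy₂' : y₂ ∉ D.dom T₁ := fun h => hdisj _ h hy₂
    refine ⟨fun x => if x ∈ D.dom T₁ then (w₁ ^^ D.val T₁ y₁) ^^ D.val T₁ x
      else (w₂ ^^ D.val T₂ y₂) ^^ D.val T₂ x, ⟨_, fun x hx => if_pos hx⟩,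
      ⟨_, fun x hx => if_neg fun h => hdisj x h hx⟩, ?_, ?_⟩
    · simp [hy₁]
    · simp [hy₂']
  refine ⟨Finset.card_le_two, ?_, ?_, ?_, ?_⟩
  · rintro a ⟨h1, h2, -⟩ T hT
    rcases Finset.mem_insert.1 hT with rfl | hT
    · exact h1
    · rwa [Finset.mem_singleton.1 hT]
  · rintro a a' heq ⟨⟨b₁, h1⟩, ⟨b₂, h2⟩, h3⟩
    have e₁ := heq T₁ (Finset.mem_insert_self _ _)
    have e₂ := heq T₂ (Finset.mem_insert_of_mem (Finset.mem_singleton_self _))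
    exact ⟨⟨b₁, fun x hx => (e₁ x hx).symm.trans (h1 x hx)⟩,
      ⟨b₂, fun x hx => (e₂ x hx).symm.trans (h2 x hx)⟩, by rwa [← e₁ x₁ hx₁, ← e₂ x₂ hx₂]⟩
  · obtain ⟨a, h1, h2, h3, -⟩ := key x₁ hx₁ x₂ hx₂ v₁ v₂
    exact ⟨a, h1, h2, Or.inl h3⟩
  · intro T hT x hx v
    rcases Finset.mem_insert.1 hT with rfl | hT
    · obtain ⟨a, h1, h2, h3, h4⟩ := key x hx x₂ hx₂ v v₂
      exact ⟨a, ⟨h1, h2, Or.inr h4⟩, h3⟩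
    · obtain rfl := Finset.mem_singleton.1 hT
      obtain ⟨a, h1, h2, h3, h4⟩ := key x₁ hx₁ x hx v₁ v
      exact ⟨a, ⟨h1, h2, Or.inl h3⟩, h4⟩

/-- The block that consists of a single piece, without further constraint. -/
def singleBlock (D : PiecewiseFamily φ μ P) (T : P) : Block V P where
  pieces := {T}
  allowed := {a | D.Consistent T a}

lemma isValid_singleBlock (T : P) : (singleBlock D T).IsValid D := by
  refine ⟨by simp [singleBlock], ?_, ?_, ⟨D.val T, false, by simp⟩, ?_⟩
  · rintro a ha T' hT'
    rwa [Finset.mem_singleton.1 hT']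
  · rintro a a' heq ⟨b, hb⟩
    exact ⟨b, fun x hx => (heq T (Finset.mem_singleton_self T) x hx).symm.trans (hb x hx)⟩
  · intro T' hT' x _ v
    exact ⟨fun y => (v ^^ D.val T x) ^^ D.val T y, ⟨_, fun y _ => rfl⟩, by simp⟩

/-- **Locality lemma.** As far as the values of the monomials in `s` are concerned, a block family
can be replaced by one with at most `2 * #s` blocks. The blocks touched by an overfull set of
monomials are kept. Every other monomial owns two blocks that it touches; these are replaced by a
pair of pieces, one from each, with the constraint that one of two variables annihilates the
monomial. -/
theorem IsBlockFamily.exists_card_le (h : IsBlockFamily D 𝓑) (𝔽 : Type*) [Field 𝔽]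
    (s : Finset ((V ⊕ V) →₀ ℕ)) :
    ∃ 𝓑' : Finset (Block V P), IsBlockFamily D 𝓑' ∧ 𝓑'.card ≤ 2 * s.card ∧
      ∀ a', Meets 𝓑' a' → ∃ a, Meets 𝓑 a ∧ ∀ m ∈ s, monVal 𝔽 a m = monVal 𝔽 a' m := by
  classical
  let N : ((V ⊕ V) →₀ ℕ) → Finset (Block V P) := fun m =>
    𝓑.filter fun B => ∃ T ∈ B.pieces, ∃ x ∈ D.dom T, Touches m x
  obtain ⟨s', hs', hcard, f, hf, hfN⟩ := exists_subset_double_matching s N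
  set K := s'.biUnion N
  have hK𝓑 : K ⊆ 𝓑 := Finset.biUnion_subset.2 fun m _ => Finset.filter_subset _ _
  have hf𝓑 : ∀ p, f p ∈ 𝓑 := fun p =>
    (Finset.mem_filter.1 (Finset.mem_sdiff.1 (hfN p)).1).1
  have hfK : ∀ p, f p ∉ K := fun p => (Finset.mem_sdiff.1 (hfN p)).2
  choose T hT x hx hxm using fun p => (Finset.mem_filter.1 (Finset.mem_sdiff.1 (hfN p)).1).2
  choose v hv using fun p => exists_monVal_eq_zero (𝔽 := 𝔽) (hxm p)
  have hne : ∀ m, f (m, true) ≠ f (m, false) := fun m he => by simpa using hf he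
  let nb : {m // m ∈ s \ s'} → Block V P := fun m =>
    pairBlock D (T (m, true)) (T (m, false)) (x (m, true)) (x (m, false)) (v (m, true))
      (v (m, false))
  have hnb_valid : ∀ m, (nb m).IsValid D := fun m =>
    isValid_pairBlock (fun y hy hy' => hne m
      (h.eq_of_mem_dom (hf𝓑 _) (hf𝓑 _) (hT _) (hT _) hy hy')) (hx _) (hx _) _ _
  have hnb_pieces : ∀ m, ∀ S ∈ (nb m).pieces, ∃ b, S = T (m, b) := by
    intro m S hS
    rcases Finset.mem_insert.1 hS with hS | hS
    · exact ⟨true, hS⟩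
    · exact ⟨false, Finset.mem_singleton.1 hS⟩
  refine ⟨K ∪ Finset.univ.image nb, ⟨?_, ?_, ?_⟩, ?_, ?_⟩
  · intro B hB
    rcases Finset.mem_union.1 hB with hB | hB
    · exact h.valid B (hK𝓑 hB)
    · obtain ⟨m, -, rfl⟩ := Finset.mem_image.1 hB
      exact hnb_valid m
  · have mixed : ∀ B ∈ K, ∀ m, ∀ S, S ∈ B.pieces → S ∈ (nb m).pieces → False := by
      intro B hB m S hS hS'
      obtain ⟨b, rfl⟩ := hnb_pieces m S hS'
      exact hfK (m, b) (h.disjoint _ (hf𝓑 _) B (hK𝓑 hB) _ (hT _) hS ▸ hB)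
    intro B hB B' hB' S hS hS'
    rcases Finset.mem_union.1 hB with hB | hB <;> rcases Finset.mem_union.1 hB' with hB' | hB'
    · exact h.disjoint B (hK𝓑 hB) B' (hK𝓑 hB') S hS hS'
    · obtain ⟨m, -, rfl⟩ := Finset.mem_image.1 hB'
      exact (mixed B hB m S hS hS').elim
    · obtain ⟨m, -, rfl⟩ := Finset.mem_image.1 hB
      exact (mixed B' hB' m S hS' hS).elim
    · obtain ⟨m, -, rfl⟩ := Finset.mem_image.1 hB
      obtain ⟨m', -, rfl⟩ := Finset.mem_image.1 hB'
      obtain ⟨b, rfl⟩ := hnb_pieces m S hS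
      obtain ⟨b', hb'⟩ := hnb_pieces m' _ hS'
      have := hf (h.disjoint _ (hf𝓑 _) _ (hf𝓑 _) _ (hT (m, b)) (hb' ▸ hT (m', b')))
      exact congrArg nb (Prod.ext_iff.1 this).1
  · refine D.mono h.mem_positions fun S hS => ?_
    obtain ⟨B, hB, hS⟩ := Finset.mem_biUnion.1 hS
    rcases Finset.mem_union.1 hB with hB | hB
    · exact Finset.mem_biUnion.2 ⟨B, hK𝓑 hB, hS⟩
    · obtain ⟨m, -, rfl⟩ := Finset.mem_image.1 hB
      obtain ⟨b, rfl⟩ := hnb_pieces m S hS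
      exact Finset.mem_biUnion.2 ⟨_, hf𝓑 _, hT _⟩
  · have h1 := Finset.card_union_le K (Finset.univ.image nb)
    have h2 : (Finset.univ.image nb).card ≤ (s \ s').card :=
      Finset.card_image_le.trans (by simp)
    have h3 := Finset.card_sdiff_add_card_eq_card hs'
    omega
  · intro a' ha'
    -- On a block owned by a monomial follow `a'` at the annihilating variable.
    have hc : ∀ B ∈ 𝓑, ∃ c ∈ B.allowed, (B ∈ K → c = a') ∧
        ∀ p, f p = B → c (x p) = a' (x p) := by
      intro B hB
      by_cases hBK : B ∈ K
      · exact ⟨a', ha' B (Finset.mem_union_left _ hBK), fun _ => rfl, fun p hp =>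
          absurd (hp ▸ hBK) (hfK p)⟩
      · by_cases hp : ∃ p, f p = B
        · obtain ⟨p, rfl⟩ := hp
          obtain ⟨c, hc, hcx⟩ := (h.valid _ hB).flip _ (hT p) _ (hx p) (a' (x p))
          refine ⟨c, hc, fun h => absurd h hBK, fun q hq => ?_⟩
          rw [hf hq, hcx]
        · obtain ⟨c, hc⟩ := (h.valid _ hB).nonempty
          exact ⟨c, hc, fun h => absurd h hBK, fun q hq => absurd ⟨q, hq⟩ hp⟩
    choose! c hcB hcK hcx using hc
    obtain ⟨a, ha, hac, haout⟩ := h.exists_glue c hcB a'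
    refine ⟨a, ha, fun m hm => ?_⟩
    by_cases hms : m ∈ s'
    · refine monVal_congr fun y hy => ?_
      by_cases hyB : ∃ B ∈ 𝓑, ∃ S ∈ B.pieces, y ∈ D.dom S
      · obtain ⟨B, hB, S, hS, hyS⟩ := hyB
        have hBK : B ∈ K := Finset.mem_biUnion.2
          ⟨m, hms, Finset.mem_filter.2 ⟨hB, S, hS, y, hyS, hy⟩⟩
        rw [hac B hB S hS y hyS, hcK B hB hBK]
      · exact haout y fun B hB S hS hyS => hyB ⟨B, hB, S, hS, hyS⟩
    · let m' : {m // m ∈ s \ s'} := ⟨m, Finset.mem_sdiff.2 ⟨hm, hms⟩⟩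
      have hax : ∀ b, a (x (m', b)) = a' (x (m', b)) := fun b => by
        rw [hac _ (hf𝓑 (m', b)) _ (hT _) _ (hx _)]
        exact hcx _ (hf𝓑 _) _ rfl
      have hmeet : a' ∈ (nb m').allowed :=
        ha' _ (Finset.mem_union_right _ (Finset.mem_image_of_mem _ (Finset.mem_univ _)))
      obtain ⟨b, hb⟩ : ∃ b, a' (x (m', b)) = v (m', b) := by
        rcases hmeet.2.2 with h | h
        · exact ⟨true, h⟩
        · exact ⟨false, h⟩
      rw [hv (m', b) a' hb, hv (m', b) a ((hax b).trans hb)]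

end Locality

/-! ### Monomial space in semantical PCR -/

section MonomialSpace

variable {V P : Type*} [DecidableEq V] [DecidableEq P] {φ : CNF V} {μ : ℝ} {𝔽 : Type*} [Field 𝔽]

/-- The monomials that occur in `M`. -/
def monomialsOf (M : Set (PCRPoly 𝔽 V)) : Set ((V ⊕ V) →₀ ℕ) := {m | ∃ p ∈ M, m ∈ p.support}

/-- All assignments that meet a suitable block family of at most `n` blocks are zeros of `M`. -/
def HasBlocks (D : PiecewiseFamily φ μ P) (M : Set (PCRPoly 𝔽 V))
    (n : ℕ) : Prop :=
  ∃ 𝓑 : Finset (Block V P), IsBlockFamily D 𝓑 ∧ 𝓑.card ≤ n ∧ ∀ a, Meets 𝓑 a → IsZeroOf a M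

variable {D : PiecewiseFamily φ μ P} {M M' : Set (PCRPoly 𝔽 V)}

lemma HasBlocks.of_encard_le {n k : ℕ} (h : HasBlocks D M n) (hM : (monomialsOf M).encard ≤ k) :
    HasBlocks D M (2 * k) := by
  obtain ⟨𝓑, h𝓑, -, hzero⟩ := h
  have hfin : (monomialsOf M).Finite := Set.finite_of_encard_le_coe hM
  obtain ⟨𝓑', h𝓑', hcard, hval⟩ := h𝓑.exists_card_le 𝔽 hfin.toFinset
  refine ⟨𝓑', h𝓑', hcard.trans ?_, fun a' ha' p hp => ?_⟩
  · rw [hfin.encard_eq_coe_toFinset_card] at hM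
    have : hfin.toFinset.card ≤ k := by exact_mod_cast hM
    omega
  · obtain ⟨a, ha, heq⟩ := hval a' ha'
    have h0 := hzero a ha p hp
    rw [eval_boolPoint] at h0 ⊢
    rw [← h0]
    exact Finset.sum_congr rfl fun m hm => by
      rw [heq m (hfin.mem_toFinset.2 ⟨p, hp, hm⟩)]

lemma HasBlocks.step {n : ℕ} (h : HasBlocks D M n) (hn : ((2 * n : ℕ) : ℝ) < μ)
    (hstep : SemPCRStep (trCNF 𝔽 φ) M M') : ∃ n', HasBlocks D M' n' := by
  classical
  obtain ⟨𝓑, h𝓑, hcard, hzero⟩ := h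
  cases hstep with
  | download p hp =>
    by_cases hax : ∃ C ∈ φ, p = trClause 𝔽 C
    · obtain ⟨C, hC, rfl⟩ := hax
      have hlt : ((𝓑.biUnion Block.pieces).card : ℝ) < μ := by
        refine lt_of_le_of_lt ?_ hn
        have := h𝓑.card_pieces_le
        exact_mod_cast this.trans (Nat.mul_le_mul_left 2 hcard)
      obtain ⟨T, hT, hsat⟩ := D.extend_clause h𝓑.mem_positions hlt hC
      have hCsat : ∀ a, D.Consistent T a → Clause.Sat a C := by
        rintro a ⟨b, hb⟩
        obtain ⟨l, hl, hx, hv⟩ := hsat b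
        exact ⟨l, hl, (hb _ hx).trans hv⟩
      have hins : ∀ a, IsZeroOf a M → D.Consistent T a → IsZeroOf a (M ∪ {trClause 𝔽 C}) := by
        rintro a ha hTa p (hp | rfl)
        · exact ha p hp
        · exact eval_boolPoint_trClause (hCsat a hTa)
      by_cases hT𝓑 : T ∈ 𝓑.biUnion Block.pieces
      · obtain ⟨B, hB, hTB⟩ := Finset.mem_biUnion.1 hT𝓑
        exact ⟨n, 𝓑, h𝓑, hcard, fun a ha =>
          hins a (hzero a ha) ((h𝓑.valid B hB).consistent a (ha B hB) T hTB)⟩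
      · have hnew : ∀ B ∈ 𝓑, T ∉ B.pieces := fun B hB hTB =>
          hT𝓑 (Finset.mem_biUnion.2 ⟨B, hB, hTB⟩)
        refine ⟨_, insert (singleBlock D T) 𝓑, ⟨?_, ?_, ?_⟩, le_rfl, fun a ha => ?_⟩
        · intro B hB
          rcases Finset.mem_insert.1 hB with rfl | hB
          · exact isValid_singleBlock T
          · exact h𝓑.valid B hB
        · intro B hB B' hB' S hS hS'
          rcases Finset.mem_insert.1 hB with rfl | hB₁ <;>
            rcases Finset.mem_insert.1 hB' with rfl | hB₁'
          · rfl
          · obtain rfl := Finset.mem_singleton.1 hS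
            exact absurd hS' (hnew B' hB₁')
          · obtain rfl := Finset.mem_singleton.1 hS'
            exact absurd hS (hnew B hB₁)
          · exact h𝓑.disjoint B hB₁ B' hB₁' S hS hS'
        · rw [Finset.biUnion_insert]
          exact hT
        · exact hins a (hzero a fun B hB => ha B (Finset.mem_insert_of_mem hB))
            (ha _ (Finset.mem_insert_self _ _))
    · -- The Boolean axioms vanish everywhere.
      refine ⟨n, 𝓑, h𝓑, hcard, fun a ha => ?_⟩
      rintro q (hq | rfl)
      · exact hzero a ha q hq
      · exact eval_boolPoint_eq_zero_of_mem_trCNF hp fun C hC he => absurd ⟨C, hC, he⟩ hax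
  | inference _ hspan =>
    exact ⟨n, 𝓑, h𝓑, hcard, fun a ha q hq => (hzero a ha).span (hspan q hq)⟩
  | erasure _ hsub => exact ⟨n, 𝓑, h𝓑, hcard, fun a ha q hq => hzero a ha q (hsub hq)⟩

/-- As long as the number of monomials in memory stays below `μ / 4`, every configuration vanishes
on all assignments that meet some block family. Such assignments exist, so `1` is never derived. -/
theorem PiecewiseFamily.ofReal_le_monomialSpace (D : PiecewiseFamily φ μ P)
    (π : SemPCRRefutation (trCNF 𝔽 φ)) :
    ENNReal.ofReal (μ / 4) ≤ (π.monomialSpace : ENNReal) := by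
  classical
  by_contra! hlt
  obtain ⟨k, hk⟩ : ∃ k : ℕ, π.monomialSpace = k := by
    refine ENat.ne_top_iff_exists.1 (fun htop => ?_) |>.imp fun _ h => h.symm
    simp [htop] at hlt
  have hkμ : ((2 * (2 * k) : ℕ) : ℝ) < μ := by
    rw [hk] at hlt
    have : (k : ℝ) < μ / 4 := by
      rw [ENat.toENNReal_coe, ENNReal.lt_ofReal_iff_toReal_lt (by simp)] at hlt
      simpa using hlt
    push_cast
    linarith
  have hmon : ∀ i, (monomialsOf (π.config i)).encard ≤ k := fun i => by
    rw [← hk]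
    exact le_iSup (fun i => (monomialsOf (π.config i)).encard) i
  have hblocks : ∀ i, HasBlocks D (π.config i) (2 * k) := by
    intro i
    induction i using Fin.induction with
    | zero =>
      refine ⟨∅, ⟨by simp, by simp, by simpa using D.empty_mem⟩, by simp, fun a _ => ?_⟩
      rw [π.init]
      exact fun p hp => hp.elim
    | succ i ih =>
      obtain ⟨n, hn⟩ := ih.step hkμ (π.step i)
      exact hn.of_encard_le (hmon _)
  obtain ⟨𝓑, h𝓑, -, hzero⟩ := hblocks (Fin.last _)
  choose! c hc using fun B hB => (h𝓑.valid B hB).nonempty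
  obtain ⟨a, ha, -⟩ := h𝓑.exists_glue c hc (fun _ => false)
  simpa using hzero a ha 1 π.final

end MonomialSpace

end SpaceComplexity

theorem mainTheorem7 {V : Type*} [DecidableEq V] (φ : SpaceComplexity.CNF V)
    (h3 : SpaceComplexity.CNF.IsKCNF 3 φ) (hunsat : SpaceComplexity.CNF.Unsatisfiable φ)
    (μ : ℝ) (hμ : 0 ≤ μ)
    (hwin : SpaceComplexity.CoverWins 2 4 (SpaceComplexity.CNF.adjacencyGraph φ) μ) :
    (∀ (𝔽 : Type*) [Field 𝔽]
      (π : SpaceComplexity.SemPCRRefutation (SpaceComplexity.trCNF 𝔽 φ)),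
      ENNReal.ofReal (μ / 4) ≤ (π.monomialSpace : ENNReal)) ∧
    (∀ π : SpaceComplexity.ResRefutation φ,
      (∃ i, μ / 2 ≤ (((π.config i).filter fun C => μ / 2 ≤ (C.card : ℝ)).card : ℝ)) ∧
      μ ^ 2 / 4 ≤ (π.totalSpace : ℝ)) := by
  classical
  obtain ⟨D⟩ := hwin.nonempty_piecewiseFamily
  refine ⟨fun 𝔽 _ π => D.ofReal_le_monomialSpace π, fun π => ?_⟩
  obtain ⟨i, hi⟩ := D.exists_card_wideClauses_ge π
  exact ⟨⟨i, hi⟩, π.sq_div_four_le_totalSpace hμ hi⟩
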